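/- **Setting.** There are $n\ge 1$ agents and $m\ge 2$ alternatives. Every agent $i$ has a value $\mathrm{val}_i(a)\ge 0$ for every alternative $a$; all $nm$ values are drawn independently from a known distribution $F$. Given the valuations $v=(\mathrm{val}_i)_i$, a profile $P=(\succ_i)_i$ of rankings is drawn uniformly at random among all profiles consistent with $v$ (that is, $a\succ_i a'$ only if $\mathrm{val}_i(a)\ge \mathrm{val}_i(a')$). Let $\mathrm{sw}(a,v)=\sum_i \mathrm{val}_i(a)$. The average distortion of a (randomized) mechanism $\mathcal M$, which may use $F$, on a family $\mathcal F$ of distributions is $$\sup_{F\in\mathcal F}\frac{\mathbb E_{v}\left[\max_a \mathrm{sw}(a,v)\right]}{\mathbb E_{v,P,\mathcal M}\left[\mathrm{sw}(\mathcal M(P,v),v)\right]}.$$ **Mechanisms.** For $p\in[0,1]$ and $0/1$ valuations, the mechanism *Mean* queries every agent for her value of the alternative at position $\tau=\max\{1,\lfloor pm\rfloor\}$ of her ranking, and returns an alternative $a$ that maximizes the number of agents whose answer is $1$ and who rank $a$ at position at most $\tau$, breaking ties arbitrarily. The mechanism *RtMean* with thresholds $0<\ell_1<\dots<\ell_r$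 ($r\ge 1$) picks $t\in\{1,\dots,r\}$ uniformly at random, sets $p=\Pr_{z\sim F}[z\ge \ell_t]$, and runs Mean for this $p$, interpreting the answer $\mathrm{val}_i(a)$ to a query as $1$ if $\mathrm{val}_i(a)\ge\ell_t$ and as $0$ otherwise. **Statement.** There is an absolute constant $C>0$ such that for every $m\ge 2$ there is a choice of thresholds, depending only on $F$ and $m$, for which, for every $n\ge 1$ and every tie-breaking in Mean, RtMean has average distortion at most $C\log m$ on each of the following families: - the exponential distributions $E(\lambda)$, $\lambda>0$, for which $\mu=\frac1\lambda$ and $\sigma^2=\frac1{\lambda^2}$; - the chi-squared distributions $\chi^2(k)$, $k\ge 1$ an integer, for which $\mu=k$ and $\sigma^2=2k$; - the Erlang-$k$ distributions $E_k(\lambda)$ (density proportional to $x^{k-1}e^{-k\lambda x}$ on $x>0$), $k\ge 1$ an integer and $\lambda>0$, for which $\mu=\frac1\lambda$ and $\sigma^2=\frac1{k\lambda^2}$. Here $\mu$ and $\sigma^2$ denote the mean and the variance. -/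

import Mathlib

open MeasureTheory ProbabilityTheory
open scoped ENNReal

noncomputable section

namespace Voting

/-- A ranking (strict ordering) of the `m` alternatives, given by the bijection that sends each
alternative to its position, counted from `0`. -/
abbrev Ranking (m : ℕ) : Type := Equiv.Perm (Fin m)

/-- The position of alternative `a` in the ranking `r`, counted from `1` (the top). -/
def pos {m : ℕ} (r : Ranking m) (a : Fin m) : ℕ := (r a : ℕ) + 1

/-- A profile: one ranking of the `m` alternatives for each of the `n` agents. -/
abbrev Profile (n m : ℕ) : Type := Fin n → Ranking m

/-- Valuations: `v i a` is the value of agent `i` for alternative `a`. -/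
abbrev Valuation (n m : ℕ) : Type := Fin n → Fin m → ℝ

/-- The social welfare of alternative `a`. -/
def sw {n m : ℕ} (a : Fin m) (v : Valuation n m) : ℝ := ∑ i, v i a

/-- The profile `P` is consistent with `v`: whenever an agent ranks `a` above `a'`, her value
for `a` is at least her value for `a'`. -/
def Consistent {n m : ℕ} (P : Profile n m) (v : Valuation n m) : Prop :=
  ∀ i a a', pos (P i) a < pos (P i) a' → v i a' ≤ v i a

open scoped Classical in
/-- The finite set of all profiles that are consistent with `v`. -/
def consistentProfiles {n m : ℕ} (v : Valuation n m) : Finset (Profile n m) :=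
  Finset.univ.filter fun P => Consistent P v

theorem consistentProfiles_nonempty {n m : ℕ} (v : Valuation n m) :
    (consistentProfiles v).Nonempty := by
  classical
  refine ⟨fun i => (Tuple.sort fun a => -v i a).symm, ?_⟩
  simp only [consistentProfiles, Finset.mem_filter, Finset.mem_univ, true_and]
  intro i a a' h
  have h1 : (Tuple.sort fun a => -v i a).symm a ≤ (Tuple.sort fun a => -v i a).symm a' := by
    rw [Fin.le_def]
    simp only [pos] at h
    omega
  have h2 := Tuple.monotone_sort (fun a => -v i a) h1
  simp only [Function.comp_apply, Equiv.apply_symm_apply] at h2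
  linarith

/-- A profile chosen uniformly at random among all profiles consistent with `v`. -/
def randomProfile {n m : ℕ} (v : Valuation n m) : PMF (Profile n m) :=
  PMF.uniformOfFinset (consistentProfiles v) (consistentProfiles_nonempty v)

/-- The law of random valuations: all values `v i a` are independent with law `F`. -/
def valuationLaw (n m : ℕ) (F : Measure ℝ) : Measure (Valuation n m) :=
  Measure.pi fun _ => Measure.pi fun _ => F

/-- A deterministic mechanism. -/
abbrev Mechanism (n m : ℕ) : Type := Profile n m → Valuation n m → Fin m

/-- A randomized mechanism: it returns a random alternative. -/
abbrev RandMechanism (n m : ℕ) : Type := Profile n m → Valuation n m → PMF (Fin m)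

/-- The expected maximum social welfare when all values are drawn from `F`. -/
def expectedMaxWelfare (n m : ℕ) (F : Measure ℝ) : ℝ≥0∞ :=
  ∫⁻ v, ⨆ a : Fin m, ENNReal.ofReal (sw a v) ∂(valuationLaw n m F)

/-- The expected social welfare of the alternative returned by `M`, over the random valuations,
the random consistent profile, and the random choices of `M`. -/
def expectedWelfare {n m : ℕ} (M : RandMechanism n m) (F : Measure ℝ) : ℝ≥0∞ :=
  ∫⁻ v, ∑ P, randomProfile v P * ∑ a, M P v a * ENNReal.ofReal (sw a v) ∂(valuationLaw n m F)

/-- The average distortion of a mechanism on a family of distributions. The distribution is known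
to the mechanism, hence the argument of type `Measure ℝ`. -/
def avgDistortion {n m : ℕ} (M : Measure ℝ → RandMechanism n m) (𝓕 : Set (Measure ℝ)) : ℝ≥0∞ :=
  ⨆ F ∈ 𝓕, expectedMaxWelfare n m F / expectedWelfare (M F) F

open scoped Classical in
/-- The implied social welfare of `a` for queries at position `k`: the number of agents whose
value for the alternative at position `k` is `1` and who rank `a` at position at most `k`. -/
def impliedSW {n m : ℕ} (a : Fin m) (P : Profile n m) (v : Valuation n m) (k : ℕ) : ℕ :=
  ∑ i, if (∃ b, pos (P i) b = k ∧ v i b = 1) ∧ pos (P i) a ≤ k then 1 else 0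

/-- The position `max {1, ⌊p m⌋}` that mechanism Mean queries for the binary distribution with
success probability `p`. -/
def queryPos (p : ℝ) (m : ℕ) : ℕ := max 1 ⌊p * m⌋₊

/-- `M p` is mechanism Mean for the binary distribution with success probability `p`, under some
tie-breaking: it returns a maximizer of the implied social welfare. Ties may be broken in any
way, in particular as a function of the profile and the answers to the queries. -/
def IsMean {n m : ℕ} (M : ℝ → Mechanism n m) : Prop :=
  ∀ p ∈ Set.Icc (0 : ℝ) 1, ∀ P v a,
    impliedSW a P v (queryPos p m) ≤ impliedSW (M p P v) P v (queryPos p m)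

/-- The parameters of mechanism RtMean: thresholds `0 < ℓ 0 < ℓ 1 < ... < ℓ (k - 1)`, `1 ≤ k`. -/
structure Thresholds where
  k : ℕ
  k_pos : 0 < k
  ℓ : Fin k → ℝ
  ℓ_pos : ∀ t, 0 < ℓ t
  ℓ_strictMono : StrictMono ℓ

open scoped Classical in
/-- The binary valuations with value `1` where `v` is at least the threshold `l`. -/
def binarize {n m : ℕ} (l : ℝ) (v : Valuation n m) : Valuation n m :=
  fun i a => if l ≤ v i a then 1 else 0

/-- Mechanism RtMean with thresholds `T` for the distribution `F`, built on the implementation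
`M` of mechanism Mean: choose a threshold uniformly at random and run Mean, for the probability
`p` that a value drawn from `F` is at least the threshold, on the binarized valuations. -/
def rtMean {n m : ℕ} (M : ℝ → Mechanism n m) (T : Thresholds) (F : Measure ℝ) :
    RandMechanism n m := fun P v =>
  haveI : Nonempty (Fin T.k) := ⟨⟨0, T.k_pos⟩⟩
  (PMF.uniformOfFintype (Fin T.k)).map fun t =>
    M (F.real (Set.Ici (T.ℓ t))) P (binarize (T.ℓ t) v)

/-- The chi-squared distribution with `k` degrees of freedom: density proportional to
`x ^ (k / 2 - 1) * exp (-x / 2)` on the positive reals. -/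
def chiSquared (k : ℕ) : Measure ℝ := gammaMeasure ((k : ℝ) / 2) (1 / 2)

/-- The Erlang-`k` distribution `E_k(lam)` with mean `1 / lam`: density proportional to
`x ^ (k - 1) * exp (-k * lam * x)` on the positive reals. -/
def erlang (k : ℕ) (lam : ℝ) : Measure ℝ := gammaMeasure k (k * lam)

/-- The family of all exponential distributions. -/
def exponentialFamily : Set (Measure ℝ) := {F | ∃ lam : ℝ, 0 < lam ∧ F = expMeasure lam}

/-- The family of all chi-squared distributions. -/
def chiSquaredFamily : Set (Measure ℝ) := {F | ∃ k : ℕ, 0 < k ∧ F = chiSquared k}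

/-- The family of all Erlang distributions. -/
def erlangFamily : Set (Measure ℝ) :=
  {F | ∃ (k : ℕ) (lam : ℝ), 0 < k ∧ 0 < lam ∧ F = erlang k lam}

end Voting

end

/-!
The threshold is a median `l` of `F`, so Mean queries position `max {1, ⌊m / 2⌋} ≥ m / 3`. Swapping
heads and tails of fair coins shows that, with probability at least `1 / 2`, an agent has that many
values above `l` and hence answers `1`. Averaging the implied welfare over the alternatives, the
winner has expected welfare at least `n * l / 6`. On the other side, no alternative beats the sum of
the agents' largest values, and an exponential-moment estimate bounds each of these in expectation
by `(log m + cgf s) / s`.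

All three families consist of gamma distributions of shape `a ≥ 1 / 2`. At rate `r` and `s = r / 2`
the second bound is `2 * (log m + a * log 2) / r`, while the Chernoff bound for the lower tail shows
that the median is at least a constant fraction of the mean `a / r`; the quotient is `O (log m)`.
-/

section Quantile

theorem continuous_cdf {F : Measure ℝ} [IsProbabilityMeasure F] [NullSingletonClass F] :
    Continuous (cdf F) := by
  refine continuous_iff_continuousAt.2 fun x =>
    continuousAt_iff_continuous_left_right.2 ⟨?_, (cdf F).right_continuous x⟩
  have hjump : ENNReal.ofReal (cdf F x - Function.leftLim (cdf F) x) = 0 := by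
    rw [← StieltjesFunction.measure_singleton, measure_cdf, measure_singleton]
  rw [← continuousWithinAt_Iio_iff_Iic, (monotone_cdf F).continuousWithinAt_Iio_iff_leftLim_eq]
  exact le_antisymm ((monotone_cdf F).leftLim_le le_rfl)
    (sub_nonpos.1 (ENNReal.ofReal_eq_zero.1 hjump))

theorem exists_cdf_eq {F : Measure ℝ} [IsProbabilityMeasure F] [NullSingletonClass F] {q : ℝ}
    (hq : q ∈ Set.Ioo (0 : ℝ) 1) : ∃ l, cdf F l = q :=
  mem_range_of_exists_le_of_exists_ge continuous_cdf
    ((tendsto_cdf_atBot F).eventually_le_const hq.1).exists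
    ((tendsto_cdf_atTop F).eventually_const_le hq.2).exists

theorem measureReal_Ici_eq_one_sub_cdf {F : Measure ℝ} [IsProbabilityMeasure F]
    [NullSingletonClass F] (x : ℝ) : F.real (Set.Ici x) = 1 - cdf F x := by
  rw [cdf_eq_real, ← Set.compl_Iio, probReal_compl_eq_one_sub measurableSet_Iio,
    measureReal_congr Iio_ae_eq_Iic]

theorem exists_pos_measureReal_Ici_eq {F : Measure ℝ} [IsProbabilityMeasure F]
    [NullSingletonClass F] (hF : ∀ᵐ x ∂F, 0 ≤ x) {q : ℝ} (hq : q ∈ Set.Ioo (0 : ℝ) 1) :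
    ∃ l, 0 < l ∧ F.real (Set.Ici l) = q := by
  obtain ⟨l, hl⟩ := exists_cdf_eq (F := F) (q := 1 - q) ⟨sub_pos.2 hq.2, sub_lt_self _ hq.1⟩
  refine ⟨l, (monotone_cdf F).reflect_lt ?_, by rw [measureReal_Ici_eq_one_sub_cdf, hl]; ring⟩
  have hzero : cdf F 0 = 0 := by
    rw [cdf_eq_real, ← measureReal_congr Iio_ae_eq_Iic, measureReal_def, ENNReal.toReal_eq_zero_iff]
    exact .inl (by simpa [ae_iff, Set.Iio] using hF)
  rw [hzero, hl]
  exact sub_pos.2 hq.2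

end Quantile

section MaximalInequality

variable {Ω ι : Type*} {mΩ : MeasurableSpace Ω} {μ : Measure Ω} [IsProbabilityMeasure μ]

theorem integral_exp_mul_sub_eq {X : Ω → ℝ} {s : ℝ}
    (hX : Integrable (fun ω => Real.exp (s * X ω)) μ) (t : ℝ) :
    ∫ ω, Real.exp (s * (X ω - t)) ∂μ = Real.exp (cgf X μ s - s * t) := by
  simp_rw [mul_sub, Real.exp_sub, integral_div, exp_cgf hX, mgf]

theorem le_sub_add_sum_exp_div [Fintype ι] {s : ℝ} (hs : 0 < s) (t : ℝ) (y : ι → ℝ) (i : ι) :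
    y i ≤ t - 1 / s + (∑ j, Real.exp (s * (y j - t))) / s := by
  have htangent := Real.add_one_le_exp (s * (y i - t))
  have hterm : Real.exp (s * (y i - t)) ≤ ∑ j, Real.exp (s * (y j - t)) :=
    Finset.single_le_sum (f := fun j => Real.exp (s * (y j - t)))
      (fun j _ => (Real.exp_pos _).le) (Finset.mem_univ i)
  have hdiv : y i - t + 1 / s ≤ (∑ j, Real.exp (s * (y j - t))) / s := by
    rw [le_div_iff₀ hs, add_mul, one_div_mul_cancel hs.ne', mul_comm]
    exact htangent.trans hterm
  linarith

theorem sum_integral_exp_mul_sub_le_one [Fintype ι] {X : ι → Ω → ℝ} {s t K : ℝ}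
    (hint : ∀ i, Integrable (fun ω => Real.exp (s * X i ω)) μ) (hK : ∀ i, cgf (X i) μ s ≤ K)
    (ht : s * t = Real.log (Fintype.card ι) + K) :
    ∑ i, ∫ ω, Real.exp (s * (X i ω - t)) ∂μ ≤ 1 := by
  rcases isEmpty_or_nonempty ι with _ | _
  · simp
  have hcard : (0 : ℝ) < Fintype.card ι := Nat.cast_pos.2 Fintype.card_pos
  have hexp : ∀ i, ∫ ω, Real.exp (s * (X i ω - t)) ∂μ ≤ 1 / Fintype.card ι := fun i => by
    rw [integral_exp_mul_sub_eq (hint i), ht, one_div, ← Real.exp_log (inv_pos.2 hcard),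
      Real.log_inv]
    exact Real.exp_le_exp.2 (by linarith [hK i])
  exact (Finset.sum_le_sum fun i _ => hexp i).trans_eq (by simp [hcard.ne'])

theorem lintegral_iSup_ofReal_le_log_card_add_div [Fintype ι] {X : ι → Ω → ℝ} {s K : ℝ}
    (hs : 0 < s) (hX : ∀ i, 0 ≤ᵐ[μ] X i)
    (hint : ∀ i, Integrable (fun ω => Real.exp (s * X i ω)) μ) (hK : ∀ i, cgf (X i) μ s ≤ K) :
    ∫⁻ ω, ⨆ i, ENNReal.ofReal (X i ω) ∂μ ≤
      ENNReal.ofReal ((Real.log (Fintype.card ι) + K) / s) := by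
  rcases isEmpty_or_nonempty ι with _ | ⟨⟨i₀⟩⟩
  · simp
  set t := (Real.log (Fintype.card ι) + K) / s
  let g : Ω → ℝ := fun ω => t - 1 / s + (∑ i, Real.exp (s * (X i ω - t))) / s
  have hshift : ∀ i, Integrable (fun ω => Real.exp (s * (X i ω - t))) μ := fun i => by
    simp_rw [mul_sub, Real.exp_sub]
    exact (hint i).div_const _
  have hsum : Integrable (fun ω => (∑ i, Real.exp (s * (X i ω - t))) / s) μ :=
    (integrable_finsetSum _ fun i _ => hshift i).div_const _
  have hg : Integrable g μ := (integrable_const _).add hsum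
  have hle : ∀ i ω, X i ω ≤ g ω := fun i ω => le_sub_add_sum_exp_div hs t (X · ω) i
  have hg0 : 0 ≤ᵐ[μ] g := by
    filter_upwards [hX i₀] with ω hω using hω.trans (hle i₀ ω)
  have hgt : ∫ ω, g ω ∂μ ≤ t := by
    have htotal := sum_integral_exp_mul_sub_le_one hint hK (mul_div_cancel₀ _ hs.ne')
    rw [integral_add (integrable_const _) hsum, integral_div,
      integral_finsetSum _ fun i _ => hshift i]
    simp only [integral_const, probReal_univ, one_smul]
    linarith [div_le_div_of_nonneg_right htotal hs.le]
  calc ∫⁻ ω, ⨆ i, ENNReal.ofReal (X i ω) ∂μ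
      ≤ ∫⁻ ω, ENNReal.ofReal (g ω) ∂μ :=
        lintegral_mono fun ω => iSup_le fun i => ENNReal.ofReal_le_ofReal (hle i ω)
    _ = ENNReal.ofReal (∫ ω, g ω ∂μ) := (ofReal_integral_eq_lintegral_ofReal hg hg0).symm
    _ ≤ ENNReal.ofReal t := ENNReal.ofReal_le_ofReal hgt

end MaximalInequality

section HalfSuccesses

variable {α ι : Type*} {mα : MeasurableSpace α} [Fintype ι]

theorem map_notMem_eq_map_mem {F : Measure α} [IsProbabilityMeasure F] {S : Set α}
    (hS : MeasurableSet S) (hhalf : F.real S = 1 / 2) : F.map (· ∉ S) = F.map (· ∈ S) := by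
  have hcompl : F Sᶜ = F S := by
    rw [← measureReal_eq_measureReal_iff, probReal_compl_eq_one_sub hS, hhalf]
    norm_num
  have hmem : Measurable (· ∈ S) := measurable_mem.2 hS
  refine Measure.ext_of_singleton fun p => ?_
  rw [Measure.map_apply hmem.not (measurableSet_singleton p),
    Measure.map_apply hmem (measurableSet_singleton p)]
  by_cases hp : p
  · simpa [hp, Set.preimage, Set.compl_def] using hcompl
  · simpa [hp, Set.preimage, Set.compl_def] using hcompl.symm

theorem pi_preimage_notMem_eq {F : Measure α} [IsProbabilityMeasure F] {S : Set α}
    (hS : MeasurableSet S) (hhalf : F.real S = 1 / 2) (B : Set (ι → Prop)) :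
    (Measure.pi fun _ : ι => F) ((fun x i => x i ∉ S) ⁻¹' B) =
      (Measure.pi fun _ : ι => F) ((fun x i => x i ∈ S) ⁻¹' B) := by
  have hmem : Measurable (· ∈ S) := measurable_mem.2 hS
  have := Measure.isProbabilityMeasure_map (μ := F) hmem.aemeasurable
  have := Measure.isProbabilityMeasure_map (μ := F) hmem.not.aemeasurable
  have hB : MeasurableSet B := (Set.toFinite B).measurableSet
  have hmap : (Measure.pi fun _ : ι => F).map (fun x i => x i ∉ S) =
      (Measure.pi fun _ : ι => F).map (fun x i => x i ∈ S) := by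
    rw [Measure.pi_map_pi (f := fun _ => (· ∉ S)) fun _ => hmem.not.aemeasurable,
      Measure.pi_map_pi (f := fun _ => (· ∈ S)) fun _ => hmem.aemeasurable,
      map_notMem_eq_map_mem hS hhalf]
  have hmeas : ∀ {f : α → Prop}, Measurable f → Measurable fun (x : ι → α) i => f (x i) :=
    fun hf => measurable_pi_lambda _ fun i => hf.comp (measurable_pi_apply i)
  have h := congrArg (· B) hmap
  simpa only [Measure.map_apply (hmeas hmem.not) hB, Measure.map_apply (hmeas hmem) hB] using h

open scoped Classical in
theorem half_le_pi_setOf_le_card_mem {F : Measure α} [IsProbabilityMeasure F] {S : Set α}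
    (hS : MeasurableSet S) (hhalf : F.real S = 1 / 2) {k : ℕ} (hk : 2 * k ≤ Fintype.card ι) :
    1 / 2 ≤ (Measure.pi fun _ : ι => F)
      {x | k ≤ (Finset.univ.filter fun i => x i ∈ S).card} := by
  let B : Set (ι → Prop) := {q | k ≤ (Finset.univ.filter fun i => q i).card}
  change 1 / 2 ≤ (Measure.pi fun _ : ι => F) ((fun x i => x i ∈ S) ⁻¹' B)
  set A : Set (ι → α) := (fun x i => x i ∈ S) ⁻¹' B
  set A' : Set (ι → α) := (fun x i => x i ∉ S) ⁻¹' B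
  have hsymm : (Measure.pi fun _ : ι => F) A' = (Measure.pi fun _ : ι => F) A :=
    pi_preimage_notMem_eq hS hhalf B
  have hcover : A' ∪ A = Set.univ := by
    refine Set.eq_univ_of_forall fun x => ?_
    have hcard := Finset.card_filter_add_card_filter_not (s := Finset.univ) fun i => x i ∈ S
    simp only [Finset.card_univ] at hcard
    simp only [A, A', B, Set.mem_union, Set.mem_preimage, Set.mem_ofPred_eq]
    omega
  rw [ENNReal.div_le_iff_le_mul (.inl two_ne_zero) (.inl ENNReal.ofNat_ne_top)]
  calc (1 : ℝ≥0∞)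
      = (Measure.pi fun _ : ι => F) (A' ∪ A) := by rw [hcover, measure_univ]
    _ ≤ (Measure.pi fun _ : ι => F) A' + (Measure.pi fun _ : ι => F) A := measure_union_le _ _
    _ = (Measure.pi fun _ : ι => F) A * 2 := by rw [hsymm, mul_two]

end HalfSuccesses

section Gamma

variable {a r s : ℝ}

theorem ofReal_exp_mul_gammaPDF (hr : 0 < r) (hs : s < r) (x : ℝ) :
    ENNReal.ofReal (Real.exp (s * x)) * gammaPDF a r x =
      ENNReal.ofReal ((r / (r - s)) ^ a) * gammaPDF a (r - s) x := by
  have hrs : 0 < r - s := sub_pos.2 hs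
  rcases lt_or_ge x 0 with hx | hx
  · simp only [gammaPDF_of_neg hx, mul_zero]
  · have hexp : Real.exp (-((r - s) * x)) = Real.exp (s * x) * Real.exp (-(r * x)) := by
      rw [← Real.exp_add]
      ring_nf
    have hpow := (Real.rpow_pos_of_pos hrs a).ne'
    rw [gammaPDF_of_nonneg hx, gammaPDF_of_nonneg hx, ← ENNReal.ofReal_mul (by positivity),
      ← ENNReal.ofReal_mul (by positivity), Real.div_rpow hr.le hrs.le, hexp]
    congr 1
    field_simp

theorem lintegral_ofReal_exp_mul_gammaMeasure (ha : 0 < a) (hr : 0 < r) (hs : s < r) :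
    ∫⁻ x, ENNReal.ofReal (Real.exp (s * x)) ∂gammaMeasure a r =
      ENNReal.ofReal ((r / (r - s)) ^ a) := by
  have hmeas : ∀ b, Measurable (gammaPDF a b) := fun b =>
    (measurable_gammaPDFReal a b).ennreal_ofReal
  rw [gammaMeasure, lintegral_withDensity_eq_lintegral_mul _ (hmeas r) (by fun_prop)]
  simp_rw [Pi.mul_apply, mul_comm (gammaPDF a r _), ofReal_exp_mul_gammaPDF hr hs]
  rw [lintegral_const_mul _ (hmeas _), lintegral_gammaPDF_eq_one ha (sub_pos.2 hs), mul_one]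

theorem integrable_exp_mul_gammaMeasure (ha : 0 < a) (hr : 0 < r) (hs : s < r) :
    Integrable (fun x => Real.exp (s * x)) (gammaMeasure a r) := by
  refine ⟨by fun_prop, ?_⟩
  rw [hasFiniteIntegral_iff_ofReal (.of_forall fun x => (Real.exp_pos _).le),
    lintegral_ofReal_exp_mul_gammaMeasure ha hr hs]
  exact ENNReal.ofReal_lt_top

theorem mgf_id_gammaMeasure (ha : 0 < a) (hr : 0 < r) (hs : s < r) :
    mgf id (gammaMeasure a r) s = (r / (r - s)) ^ a := by
  have : 0 < r - s := sub_pos.2 hs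
  simp only [mgf, id]
  rw [integral_eq_lintegral_of_nonneg_ae (.of_forall fun x => (Real.exp_pos _).le) (by fun_prop),
    lintegral_ofReal_exp_mul_gammaMeasure ha hr hs, ENNReal.toReal_ofReal (by positivity)]

theorem cgf_id_gammaMeasure (ha : 0 < a) (hr : 0 < r) (hs : s < r) :
    cgf id (gammaMeasure a r) s = a * Real.log (r / (r - s)) := by
  rw [cgf, mgf_id_gammaMeasure ha hr hs, Real.log_rpow (div_pos hr (sub_pos.2 hs))]

theorem hasDerivAt_cgf_id_gammaMeasure (ha : 0 < a) (hr : 0 < r) (hs : s < r) :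
    HasDerivAt (cgf id (gammaMeasure a r)) (a / (r - s)) s := by
  have hrs : r - s ≠ 0 := (sub_pos.2 hs).ne'
  have hderiv : HasDerivAt (fun u => a * (Real.log r - Real.log (r - u))) (a / (r - s)) s := by
    have := (((((hasDerivAt_id s).const_sub r).log hrs).const_sub (Real.log r)).const_mul a)
    exact this.congr_deriv (by simp only [id]; field_simp)
  refine hderiv.congr_of_eventuallyEq ?_
  filter_upwards [eventually_lt_nhds hs] with u hu
  rw [cgf_id_gammaMeasure ha hr hu, Real.log_div hr.ne' (sub_pos.2 hu).ne']

theorem iteratedDeriv_two_cgf_id_gammaMeasure (ha : 0 < a) (hr : 0 < r) (hs : s < r) :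
    iteratedDeriv 2 (cgf id (gammaMeasure a r)) s = a / (r - s) ^ 2 := by
  have hrs : r - s ≠ 0 := (sub_pos.2 hs).ne'
  have hderiv : HasDerivAt (fun u => a / (r - u)) (a / (r - s) ^ 2) s :=
    ((hasDerivAt_const s a).div ((hasDerivAt_id s).const_sub r) hrs).congr_deriv (by simp)
  rw [iteratedDeriv_succ, iteratedDeriv_one]
  refine (hderiv.congr_of_eventuallyEq ?_).deriv
  filter_upwards [eventually_lt_nhds hs] with u hu using
    (hasDerivAt_cgf_id_gammaMeasure ha hr hu).deriv

theorem zero_mem_interior_integrableExpSet_gammaMeasure (ha : 0 < a) (hr : 0 < r) :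
    0 ∈ interior (integrableExpSet id (gammaMeasure a r)) :=
  interior_maximal (fun _ hs => integrable_exp_mul_gammaMeasure ha hr hs) isOpen_Iio hr

theorem integral_id_gammaMeasure (ha : 0 < a) (hr : 0 < r) :
    ∫ x, x ∂gammaMeasure a r = a / r := by
  have := isProbabilityMeasure_gammaMeasure ha hr
  have h := deriv_cgf_zero (zero_mem_interior_integrableExpSet_gammaMeasure ha hr)
  rw [(hasDerivAt_cgf_id_gammaMeasure ha hr hr).deriv] at h
  simpa using h.symm

theorem variance_id_gammaMeasure (ha : 0 < a) (hr : 0 < r) :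
    variance id (gammaMeasure a r) = a / r ^ 2 := by
  have := isProbabilityMeasure_gammaMeasure ha hr
  have h := iteratedDeriv_two_cgf_eq_integral
    (zero_mem_interior_integrableExpSet_gammaMeasure ha hr)
  rw [iteratedDeriv_two_cgf_id_gammaMeasure ha hr hr,
    deriv_cgf_zero (zero_mem_interior_integrableExpSet_gammaMeasure ha hr)] at h
  rw [variance_eq_integral aemeasurable_id]
  simpa using h.symm

theorem ae_nonneg_gammaMeasure (a r : ℝ) : ∀ᵐ x ∂gammaMeasure a r, 0 ≤ x := by
  simp_rw [ae_iff, not_le]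
  change volume.withDensity (gammaPDF a r) (Set.Iio 0) = 0
  rw [withDensity_apply _ measurableSet_Iio, lintegral_gammaPDF_of_nonpos le_rfl]

instance nullSingletonClass_gammaMeasure (a r : ℝ) : NullSingletonClass (gammaMeasure a r) := by
  unfold gammaMeasure
  infer_instance

theorem cdf_gammaMeasure_mul_le {ε : ℝ} (ha : 0 < a) (hr : 0 < r) (hε : 0 < ε) (hε1 : ε ≤ 1) :
    cdf (gammaMeasure a r) (ε * (a / r)) ≤ (ε * Real.exp (1 - ε)) ^ a := by
  have := isProbabilityMeasure_gammaMeasure ha hr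
  -- The exponent `s = r * (1 - 1 / ε)` minimizes the Chernoff bound.
  have hs : r * (1 - 1 / ε) ≤ 0 :=
    mul_nonpos_of_nonneg_of_nonpos hr.le (sub_nonpos.2 (one_le_one_div hε hε1))
  have hratio : r / (r - r * (1 - 1 / ε)) = ε := by field_simp; ring
  rw [cdf_eq_real]
  calc (gammaMeasure a r).real (Set.Iic (ε * (a / r)))
      ≤ Real.exp (-(r * (1 - 1 / ε)) * (ε * (a / r))) *
          mgf id (gammaMeasure a r) (r * (1 - 1 / ε)) :=
        measure_le_le_exp_mul_mgf _ hs
          (integrable_exp_mul_gammaMeasure ha hr (hs.trans_lt hr))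
    _ = (ε * Real.exp (1 - ε)) ^ a := by
        rw [mgf_id_gammaMeasure ha hr (hs.trans_lt hr), hratio,
          Real.mul_rpow hε.le (Real.exp_pos _).le, ← Real.exp_mul, mul_comm]
        congr 2
        field_simp
        ring

theorem lt_of_measureReal_Ici_gammaMeasure_eq_half {l : ℝ} (ha : 0 < a) (hr : 0 < r)
    (hl : (gammaMeasure a r).real (Set.Ici l) = 1 / 2) :
    Real.exp (-(1 + Real.log 2 / a)) * (a / r) < l := by
  have := isProbabilityMeasure_gammaMeasure ha hr
  set ε := Real.exp (-(1 + Real.log 2 / a)) with hε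
  have hε0 : 0 < ε := Real.exp_pos _
  have hε1 : ε ≤ 1 := Real.exp_le_one_iff.2 (neg_nonpos.2 (by positivity))
  refine (monotone_cdf (gammaMeasure a r)).reflect_lt ?_
  calc cdf (gammaMeasure a r) (ε * (a / r))
      ≤ (ε * Real.exp (1 - ε)) ^ a := cdf_gammaMeasure_mul_le ha hr hε0 hε1
    _ < (ε * Real.exp 1) ^ a := by gcongr; linarith
    _ = 1 / 2 := by
        rw [hε, ← Real.exp_add, ← Real.exp_mul, one_div, ← Real.exp_log (inv_pos.2 two_pos),
          Real.log_inv]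
        congr 1
        field_simp
        ring
    _ = cdf (gammaMeasure a r) l := by
        linarith [measureReal_Ici_eq_one_sub_cdf (F := gammaMeasure a r) l]

end Gamma

namespace Voting

variable {n m : ℕ}

section Ranking

variable {P : Profile n m} {v : Valuation n m} {l : ℝ} {k : ℕ}

theorem pos_injective (r : Ranking m) : Function.Injective (pos r) := fun _ _ h =>
  r.injective (Fin.ext (Nat.succ_injective h))

theorem exists_pos_eq (r : Ranking m) (hk1 : 1 ≤ k) (hkm : k ≤ m) : ∃ b, pos r b = k :=
  ⟨r.symm ⟨k - 1, by omega⟩, by simp [pos, Nat.sub_add_cancel hk1]⟩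

theorem card_filter_pos_le (r : Ranking m) (hkm : k ≤ m) :
    (Finset.univ.filter fun a => pos r a ≤ k).card = k := by
  have h : (Finset.univ.filter fun a => pos r a ≤ k) =
      (Finset.univ.filter fun j : Fin m => (j : ℕ) < k).map r.symm.toEmbedding := by
    ext a
    simp [pos]
  rw [h, Finset.card_map, Fin.card_filter_val_lt, min_eq_right hkm]

theorem Consistent.le_of_pos_le (h : Consistent P v) {i : Fin n} {a b : Fin m}
    (hab : pos (P i) a ≤ pos (P i) b) : v i b ≤ v i a := by
  rcases hab.lt_or_eq with hlt | heq
  · exact h i a b hlt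
  · rw [pos_injective _ heq]

theorem binarize_eq_one_iff {i : Fin n} {a : Fin m} : binarize l v i a = 1 ↔ l ≤ v i a := by
  simp [binarize]

/-- The number of alternatives whose value is at least `l`, for a single agent with values `x`. -/
noncomputable def countGE (l : ℝ) (x : Fin m → ℝ) : ℕ := (Finset.univ.filter fun a => l ≤ x a).card

/-- The number of agents that value at least `k` alternatives at `l` or more. For every consistent
profile, these agents answer `1` when RtMean with threshold `l` queries position `k`. -/
noncomputable def numSatisfied (l : ℝ) (k : ℕ) (v : Valuation n m) : ℕ :=
  ∑ i, if k ≤ countGE l (v i) then 1 else 0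

theorem Consistent.le_of_pos_le_countGE (h : Consistent P v) {i : Fin n} {b : Fin m}
    (hb : pos (P i) b ≤ countGE l (v i)) : l ≤ v i b := by
  by_contra! hlt
  have hsub : (Finset.univ.filter fun a => l ≤ v i a) ⊆
      Finset.univ.filter fun a => pos (P i) a ≤ (P i b : ℕ) := by
    intro a ha
    simp only [Finset.mem_filter, Finset.mem_univ, true_and] at ha ⊢
    by_contra! hpos
    exact absurd (ha.trans (h.le_of_pos_le hpos)) hlt.not_ge
  have hcard : countGE l (v i) ≤ P i b :=
    (Finset.card_le_card hsub).trans_eq (card_filter_pos_le _ (P i b).is_lt.le)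
  exact absurd (hb.trans hcard) (Nat.not_succ_le_self _)

theorem Consistent.mul_impliedSW_le_sw (h : Consistent P v) (hv : ∀ i a, 0 ≤ v i a) (l : ℝ)
    (a : Fin m) (k : ℕ) : l * impliedSW a P (binarize l v) k ≤ sw a v := by
  rw [impliedSW, sw, Nat.cast_sum, Finset.mul_sum]
  refine Finset.sum_le_sum fun i _ => ?_
  split_ifs with hi
  · obtain ⟨⟨b, hb, hb1⟩, ha⟩ := hi
    rw [Nat.cast_one, mul_one]
    exact (binarize_eq_one_iff.1 hb1).trans (h.le_of_pos_le (ha.trans hb.ge))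
  · rw [Nat.cast_zero, mul_zero]
    exact hv i a

theorem Consistent.mul_numSatisfied_le_sum_impliedSW (h : Consistent P v) (l : ℝ) (hk1 : 1 ≤ k)
    (hkm : k ≤ m) : k * numSatisfied l k v ≤ ∑ a, impliedSW a P (binarize l v) k := by
  simp only [impliedSW, numSatisfied]
  rw [Finset.sum_comm, Finset.mul_sum]
  refine Finset.sum_le_sum fun i _ => ?_
  split_ifs with hi
  · obtain ⟨b, hb⟩ := exists_pos_eq (P i) hk1 hkm
    have hanswer : ∃ b, pos (P i) b = k ∧ binarize l v i b = 1 :=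
      ⟨b, hb, binarize_eq_one_iff.2 (h.le_of_pos_le_countGE (hb.trans_le hi))⟩
    simp only [hanswer, true_and, mul_one]
    rw [← Finset.card_filter, card_filter_pos_le _ hkm]
  · rw [mul_zero]
    exact Nat.zero_le _

theorem one_le_queryPos (p : ℝ) (m : ℕ) : 1 ≤ queryPos p m := le_max_left _ _

theorem queryPos_le {p : ℝ} (hp : p ≤ 1) (hm : 0 < m) : queryPos p m ≤ m :=
  max_le hm (Nat.floor_le_of_le (mul_le_of_le_one_left (Nat.cast_nonneg m) hp))

theorem queryPos_half (m : ℕ) : queryPos (1 / 2) m = max 1 (m / 2) := by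
  rw [queryPos, one_div_mul_eq_div, Nat.floor_div_ofNat, Nat.floor_natCast]

theorem two_mul_queryPos_half_le (hm : 2 ≤ m) : 2 * queryPos (1 / 2) m ≤ m := by
  rw [queryPos_half]
  omega

theorem third_le_queryPos_half_div (hm : 0 < m) : (1 / 3 : ℝ) ≤ queryPos (1 / 2) m / m := by
  have hthird : m ≤ 3 * queryPos (1 / 2) m := by
    rw [queryPos_half]
    omega
  have hcast : (m : ℝ) ≤ 3 * queryPos (1 / 2) m := mod_cast hthird
  rw [le_div_iff₀ (Nat.cast_pos.2 hm)]
  linarith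

theorem IsMean.mul_numSatisfied_le_sw {M : ℝ → Mechanism n m} (hM : IsMean M)
    (h : Consistent P v) (hv : ∀ i a, 0 ≤ v i a) (hl : 0 ≤ l) {p : ℝ}
    (hp : p ∈ Set.Icc (0 : ℝ) 1) :
    l * (queryPos p m / m) * numSatisfied l (queryPos p m) v ≤ sw (M p P (binarize l v)) v := by
  set k := queryPos p m
  set W := impliedSW (M p P (binarize l v)) P (binarize l v) k
  have hm : 0 < m := (M p P v).pos
  have hsum : k * numSatisfied l k v ≤ m * W :=
    calc k * numSatisfied l k v
        ≤ ∑ a, impliedSW a P (binarize l v) k :=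
          h.mul_numSatisfied_le_sum_impliedSW l (one_le_queryPos p m) (queryPos_le hp.2 hm)
      _ ≤ ∑ _a : Fin m, W := Finset.sum_le_sum fun a _ => hM p hp P (binarize l v) a
      _ = m * W := by rw [Finset.sum_const, Finset.card_univ, Fintype.card_fin, smul_eq_mul]
  calc l * (k / m) * numSatisfied l k v
      = l * ((k * numSatisfied l k v : ℕ) / m) := by push_cast; ring
    _ ≤ l * W := by
        refine mul_le_mul_of_nonneg_left ?_ hl
        rw [div_le_iff₀' (Nat.cast_pos.2 hm)]
        exact_mod_cast hsum
    _ ≤ sw (M p P (binarize l v)) v := h.mul_impliedSW_le_sw hv l _ k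

end Ranking

section ValuationLaw

variable {F : Measure ℝ} [IsProbabilityMeasure F]

theorem measurable_countGE (l : ℝ) : Measurable (countGE l : (Fin m → ℝ) → ℕ) := by
  unfold countGE
  simp_rw [Finset.card_filter]
  exact Finset.measurable_fun_sum _ fun a _ =>
    Measurable.ite (measurableSet_le measurable_const (measurable_pi_apply a))
      measurable_const measurable_const

theorem lintegral_valuationLaw_sum {f : (Fin m → ℝ) → ℝ≥0∞} (hf : Measurable f) :
    ∫⁻ v, ∑ i, f (v i) ∂valuationLaw n m F =
      n * ∫⁻ x, f x ∂Measure.pi fun _ : Fin m => F := by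
  have heval : ∀ i : Fin n, ∫⁻ v, f (v i) ∂valuationLaw n m F =
      ∫⁻ x, f x ∂Measure.pi fun _ : Fin m => F := fun i =>
    (measurePreserving_eval (fun _ : Fin n => Measure.pi fun _ : Fin m => F) i).lintegral_comp hf
  rw [lintegral_finsetSum (f := fun i (v : Valuation n m) => f (v i)) _
    fun i _ => hf.comp (measurable_pi_apply i)]
  simp only [heval, Finset.sum_const, Finset.card_univ, Fintype.card_fin, nsmul_eq_mul]

theorem lintegral_numSatisfied (l : ℝ) (k : ℕ) :
    ∫⁻ v : Valuation n m, numSatisfied l k v ∂valuationLaw n m F =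
      n * (Measure.pi fun _ : Fin m => F) {x | k ≤ countGE l x} := by
  have hA : MeasurableSet {x : Fin m → ℝ | k ≤ countGE l x} :=
    measurable_countGE l measurableSet_Ici
  have hsum : ∀ v : Valuation n m, (numSatisfied l k v : ℝ≥0∞) =
      ∑ i, {x : Fin m → ℝ | k ≤ countGE l x}.indicator 1 (v i) := fun v => by
    simp [numSatisfied, Set.indicator_apply]
  simp_rw [hsum]
  rw [lintegral_valuationLaw_sum (measurable_one.indicator hA), lintegral_indicator_one hA]

theorem ae_nonneg_valuationLaw (hF : ∀ᵐ x ∂F, 0 ≤ x) :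
    ∀ᵐ v ∂valuationLaw n m F, ∀ i a, 0 ≤ v i a := by
  have hagent : ∀ᵐ x ∂Measure.pi fun _ : Fin m => F, ∀ a, 0 ≤ x a :=
    ae_all_iff.2 fun a => Measure.tendsto_eval_ae_ae.eventually hF
  exact ae_all_iff.2 fun i => (Measure.tendsto_eval_ae_ae
    (μ := fun _ : Fin n => Measure.pi fun _ : Fin m => F) (i := i)).eventually hagent

theorem half_le_pi_setOf_le_countGE {l : ℝ} (hl : F.real (Set.Ici l) = 1 / 2) {k : ℕ}
    (hk : 2 * k ≤ m) : 1 / 2 ≤ (Measure.pi fun _ : Fin m => F) {x | k ≤ countGE l x} := by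
  have := half_le_pi_setOf_le_card_mem (ι := Fin m) measurableSet_Ici hl (k := k)
    (by rwa [Fintype.card_fin])
  convert! this

end ValuationLaw

section Welfare

theorem lintegral_le_expectedWelfare {F : Measure ℝ} {M : RandMechanism n m}
    {f : Valuation n m → ℝ≥0∞}
    (h : ∀ᵐ v ∂valuationLaw n m F, ∀ P, Consistent P v →
      f v ≤ ∑ a, M P v a * ENNReal.ofReal (sw a v)) :
    ∫⁻ v, f v ∂valuationLaw n m F ≤ expectedWelfare M F := by
  refine lintegral_mono_ae ?_
  filter_upwards [h] with v hv
  calc f v = ∑ P, randomProfile v P * f v := by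
        rw [← Finset.sum_mul, ← tsum_fintype (L := .unconditional _), PMF.tsum_coe, one_mul]
    _ ≤ ∑ P, randomProfile v P * ∑ a, M P v a * ENNReal.ofReal (sw a v) := by
        refine Finset.sum_le_sum fun P _ => ?_
        by_cases hP : P ∈ consistentProfiles v
        · gcongr
          exact hv P (by simpa [consistentProfiles] using hP)
        · rw [randomProfile, PMF.uniformOfFinset_apply_of_notMem _ hP, zero_mul, zero_mul]

/-- The parameters of RtMean with the single threshold `l`. -/
def Thresholds.single (l : ℝ) (hl : 0 < l) : Thresholds where
  k := 1
  k_pos := one_pos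
  ℓ _ := l
  ℓ_pos _ := hl
  ℓ_strictMono := Subsingleton.strictMono _

theorem rtMean_single (M : ℝ → Mechanism n m) {l : ℝ} (hl : 0 < l) (F : Measure ℝ)
    (P : Profile n m) (v : Valuation n m) :
    rtMean M (Thresholds.single l hl) F P v =
      PMF.pure (M (F.real (Set.Ici l)) P (binarize l v)) := by
  simp only [rtMean, Thresholds.single]
  exact PMF.map_const _ _

variable {F : Measure ℝ} [IsProbabilityMeasure F] {M : ℝ → Mechanism n m} {l s : ℝ}

theorem IsMean.le_expectedWelfare_rtMean_single (hM : IsMean M) (hF : ∀ᵐ x ∂F, 0 ≤ x)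
    (hl : 0 < l) {k : ℕ} (hk : k = queryPos (F.real (Set.Ici l)) m) :
    ENNReal.ofReal (l * (k / m)) *
        (n * (Measure.pi fun _ : Fin m => F) {x | k ≤ countGE l x}) ≤
      expectedWelfare (rtMean M (Thresholds.single l hl) F) F := by
  rw [← lintegral_numSatisfied, ← lintegral_const_mul' _ _ ENNReal.ofReal_ne_top]
  refine lintegral_le_expectedWelfare ?_
  filter_upwards [ae_nonneg_valuationLaw hF] with v hv P hP
  have hsingle : ∑ a, rtMean M (Thresholds.single l hl) F P v a * ENNReal.ofReal (sw a v) =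
      ENNReal.ofReal (sw (M (F.real (Set.Ici l)) P (binarize l v)) v) := by
    simp [rtMean_single, PMF.pure_apply]
  rw [hsingle, ← ENNReal.ofReal_natCast, ← ENNReal.ofReal_mul (by positivity), hk]
  exact ENNReal.ofReal_le_ofReal
    (hM.mul_numSatisfied_le_sw hP hv hl.le ⟨measureReal_nonneg, measureReal_le_one⟩)

theorem IsMean.le_expectedWelfare_rtMean_median (hM : IsMean M) (hF : ∀ᵐ x ∂F, 0 ≤ x)
    (hl : 0 < l) (hmed : F.real (Set.Ici l) = 1 / 2) (hm : 2 ≤ m) :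
    ENNReal.ofReal (n * (l / 6)) ≤ expectedWelfare (rtMean M (Thresholds.single l hl) F) F := by
  set k := queryPos (1 / 2) m
  have hthird : l * (1 / 3) ≤ l * (k / m) :=
    mul_le_mul_of_nonneg_left (third_le_queryPos_half_div (two_pos.trans_le hm)) hl.le
  calc ENNReal.ofReal (n * (l / 6))
      = ENNReal.ofReal (l * (1 / 3)) * (n * (1 / 2)) := by
        have hhalf : (1 / 2 : ℝ≥0∞) = ENNReal.ofReal (1 / 2) := by
          rw [ENNReal.ofReal_div_of_pos two_pos, ENNReal.ofReal_one, ENNReal.ofReal_ofNat]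
        rw [hhalf, ← ENNReal.ofReal_natCast, ← ENNReal.ofReal_mul (Nat.cast_nonneg n),
          ← ENNReal.ofReal_mul (by positivity)]
        ring_nf
    _ ≤ ENNReal.ofReal (l * (k / m)) *
          (n * (Measure.pi fun _ : Fin m => F) {x | k ≤ countGE l x}) := by
        gcongr
        exact half_le_pi_setOf_le_countGE hmed (two_mul_queryPos_half_le hm)
    _ ≤ expectedWelfare (rtMean M (Thresholds.single l hl) F) F :=
        hM.le_expectedWelfare_rtMean_single hF hl (by rw [hmed])

theorem expectedMaxWelfare_le_mul_lintegral_iSup :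
    expectedMaxWelfare n m F ≤
      n * ∫⁻ x, ⨆ a, ENNReal.ofReal (x a) ∂Measure.pi fun _ : Fin m => F := by
  have hmeas : Measurable fun x : Fin m → ℝ => ⨆ a, ENNReal.ofReal (x a) :=
    Measurable.iSup fun a => (measurable_pi_apply a).ennreal_ofReal
  rw [← lintegral_valuationLaw_sum hmeas]
  refine lintegral_mono fun v => iSup_le fun a => ?_
  calc ENNReal.ofReal (sw a v)
      ≤ ∑ i, ENNReal.ofReal (v i a) :=
        Finset.le_sum_of_subadditive ENNReal.ofReal ENNReal.ofReal_zero.le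
          (fun _ _ => ENNReal.ofReal_add_le) _ _
    _ ≤ ∑ i, ⨆ a, ENNReal.ofReal (v i a) :=
        Finset.sum_le_sum fun i _ => le_iSup (fun a => ENNReal.ofReal (v i a)) a

theorem expectedMaxWelfare_le_log_add_cgf_div (hF : ∀ᵐ x ∂F, 0 ≤ x) (hs : 0 < s)
    (hint : Integrable (fun x => Real.exp (s * x)) F) :
    expectedMaxWelfare n m F ≤ n * ENNReal.ofReal ((Real.log m + cgf id F s) / s) := by
  have hcgf : ∀ a, cgf (fun x => x a) (Measure.pi fun _ : Fin m => F) s = cgf id F s := fun a => by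
    have hmap := (measurePreserving_eval (fun _ : Fin m => F) a).map_eq
    rw [cgf, cgf, ← congrArg (mgf id · s) hmap, mgf_id_map (measurable_pi_apply a).aemeasurable]
  have hmax := lintegral_iSup_ofReal_le_log_card_add_div (X := fun a (x : Fin m → ℝ) => x a)
    (μ := Measure.pi fun _ => F) hs
    (fun a => (Measure.tendsto_eval_ae_ae (μ := fun _ => F) (i := a)).eventually hF)
    (fun a => integrable_comp_eval (μ := fun _ : Fin m => F) (i := a) hint) fun a => (hcgf a).le
  rw [Fintype.card_fin] at hmax
  refine expectedMaxWelfare_le_mul_lintegral_iSup.trans ?_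
  gcongr

theorem IsMean.distortion_rtMean_median_le (hM : IsMean M) (hF : ∀ᵐ x ∂F, 0 ≤ x) (hl : 0 < l)
    (hmed : F.real (Set.Ici l) = 1 / 2) (hm : 2 ≤ m) (hs : 0 < s)
    (hint : Integrable (fun x => Real.exp (s * x)) F) :
    expectedMaxWelfare n m F / expectedWelfare (rtMean M (Thresholds.single l hl) F) F ≤
      ENNReal.ofReal (6 * (Real.log m + cgf id F s) / (s * l)) := by
  refine ENNReal.div_le_of_le_mul ?_
  calc expectedMaxWelfare n m F
      ≤ n * ENNReal.ofReal ((Real.log m + cgf id F s) / s) :=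
        expectedMaxWelfare_le_log_add_cgf_div hF hs hint
    _ = ENNReal.ofReal (6 * (Real.log m + cgf id F s) / (s * l)) *
          ENNReal.ofReal (n * (l / 6)) := by
        rw [← ENNReal.ofReal_natCast, ← ENNReal.ofReal_mul (Nat.cast_nonneg n),
          ← ENNReal.ofReal_mul' (by positivity)]
        congr 1
        field_simp
    _ ≤ _ := by
        gcongr
        exact hM.le_expectedWelfare_rtMean_median hF hl hmed hm

end Welfare

section GammaFamily

open scoped Classical in
/-- The single threshold at a median of `F`, or at the junk value `1` if no positive `l` satisfies
`F [l, ∞) = 1 / 2`. -/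
noncomputable def medianThreshold (F : Measure ℝ) : Thresholds :=
  if h : ∃ l, 0 < l ∧ F.real (Set.Ici l) = 1 / 2 then Thresholds.single h.choose h.choose_spec.1
  else Thresholds.single 1 one_pos

theorem exists_medianThreshold_eq_single {F : Measure ℝ} [IsProbabilityMeasure F]
    [NullSingletonClass F] (hF : ∀ᵐ x ∂F, 0 ≤ x) :
    ∃ (l : ℝ) (hl : 0 < l),
      F.real (Set.Ici l) = 1 / 2 ∧ medianThreshold F = Thresholds.single l hl := by
  have h := exists_pos_measureReal_Ici_eq hF (q := 1 / 2) (by norm_num)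
  exact ⟨h.choose, h.choose_spec.1, h.choose_spec.2, dif_pos h⟩

theorem IsMean.distortion_rtMean_medianThreshold_gammaMeasure_le {M : ℝ → Mechanism n m}
    (hM : IsMean M) {a r : ℝ} (ha : 0 < a) (hr : 0 < r) (hm : 2 ≤ m) :
    expectedMaxWelfare n m (gammaMeasure a r) /
        expectedWelfare (rtMean M (medianThreshold (gammaMeasure a r)) (gammaMeasure a r))
          (gammaMeasure a r) ≤
      ENNReal.ofReal (12 * Real.exp (1 + Real.log 2 / a) * (Real.log m / a + Real.log 2)) := by
  have := isProbabilityMeasure_gammaMeasure ha hr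
  have hnonneg := ae_nonneg_gammaMeasure a r
  obtain ⟨l, hl, hmed, hT⟩ := exists_medianThreshold_eq_single hnonneg
  have hlow := lt_of_measureReal_Ici_gammaMeasure_eq_half ha hr hmed
  have hcgf : cgf id (gammaMeasure a r) (r / 2) = a * Real.log 2 := by
    rw [cgf_id_gammaMeasure ha hr (half_lt_self hr), sub_half, div_div_cancel₀ hr.ne']
  rw [hT]
  refine (hM.distortion_rtMean_median_le hnonneg hl hmed hm (half_pos hr)
    (integrable_exp_mul_gammaMeasure ha hr (half_lt_self hr))).trans (ENNReal.ofReal_le_ofReal ?_)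
  rw [hcgf]
  calc 6 * (Real.log m + a * Real.log 2) / (r / 2 * l)
      ≤ 6 * (Real.log m + a * Real.log 2) /
          (r / 2 * (Real.exp (-(1 + Real.log 2 / a)) * (a / r))) := by gcongr
    _ = 12 * Real.exp (1 + Real.log 2 / a) * (Real.log m / a + Real.log 2) := by
        rw [Real.exp_neg]
        field_simp
        ring

/-- The gamma distributions of shape at least `a₀`, at any rate. Bounding the shape from below keeps
the ratio of mean to median bounded. -/
def gammaFamily (a₀ : ℝ) : Set (Measure ℝ) := {F | ∃ a r, a₀ ≤ a ∧ 0 < r ∧ F = gammaMeasure a r}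

theorem exponentialFamily_subset_gammaFamily : exponentialFamily ⊆ gammaFamily 1 := by
  rintro _ ⟨lam, hlam, rfl⟩
  exact ⟨1, lam, le_rfl, hlam, rfl⟩

theorem chiSquaredFamily_subset_gammaFamily : chiSquaredFamily ⊆ gammaFamily (1 / 2) := by
  rintro _ ⟨k, hk, rfl⟩
  have hk1 : (1 : ℝ) ≤ k := Nat.one_le_cast.2 hk
  exact ⟨k / 2, 1 / 2, by gcongr, one_half_pos, rfl⟩

theorem erlangFamily_subset_gammaFamily : erlangFamily ⊆ gammaFamily 1 := by
  rintro _ ⟨k, lam, hk, hlam, rfl⟩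
  exact ⟨k, k * lam, Nat.one_le_cast.2 hk, mul_pos (Nat.cast_pos.2 hk) hlam, rfl⟩

theorem gammaFamily_antitone : Antitone gammaFamily := by
  rintro a₀ b₀ h _ ⟨a, r, ha, hr, rfl⟩
  exact ⟨a, r, h.trans ha, hr, rfl⟩

theorem avgDistortion_mono (M : Measure ℝ → RandMechanism n m) : Monotone (avgDistortion M) :=
  fun _ _ h => biSup_mono fun _ hF => h hF

theorem IsMean.avgDistortion_gammaFamily_le {M : ℝ → Mechanism n m} (hM : IsMean M) {a₀ : ℝ}
    (ha₀ : 0 < a₀) (hm : 2 ≤ m) :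
    avgDistortion (fun F => rtMean M (medianThreshold F) F) (gammaFamily a₀) ≤
      ENNReal.ofReal (12 * Real.exp (1 + Real.log 2 / a₀) * (1 / a₀ + 1) * Real.log m) := by
  refine iSup₂_le ?_
  rintro _ ⟨a, r, ha, hr, rfl⟩
  have ha0 : 0 < a := ha₀.trans_le ha
  refine (hM.distortion_rtMean_medianThreshold_gammaMeasure_le ha0 hr hm).trans
    (ENNReal.ofReal_le_ofReal ?_)
  have hlog : Real.log 2 ≤ Real.log m := Real.log_le_log two_pos (Nat.ofNat_le_cast.2 hm)
  calc 12 * Real.exp (1 + Real.log 2 / a) * (Real.log m / a + Real.log 2)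
      ≤ 12 * Real.exp (1 + Real.log 2 / a₀) * (Real.log m / a₀ + Real.log m) := by gcongr
    _ = 12 * Real.exp (1 + Real.log 2 / a₀) * (1 / a₀ + 1) * Real.log m := by ring

end GammaFamily

end Voting

theorem mainTheorem4_general :
    (∀ a r : ℝ, 0 < a → 0 < r →
      ∫ x, x ∂gammaMeasure a r = a / r ∧ variance id (gammaMeasure a r) = a / r ^ 2) ∧
    ∃ T : Measure ℝ → Voting.Thresholds, ∀ a₀ : ℝ, 0 < a₀ → ∃ C : ℝ, 0 < C ∧
      ∀ m : ℕ, 2 ≤ m → ∀ n : ℕ, 1 ≤ n → ∀ M : ℝ → Voting.Mechanism n m, Voting.IsMean M →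
        Voting.avgDistortion (fun F => Voting.rtMean M (T F) F) (Voting.gammaFamily a₀)
          ≤ ENNReal.ofReal (C * Real.log m) :=
  ⟨fun _ _ ha hr => ⟨integral_id_gammaMeasure ha hr, variance_id_gammaMeasure ha hr⟩,
    Voting.medianThreshold, fun _ ha₀ =>
      ⟨_, by positivity, fun _ hm _ _ _ hM => hM.avgDistortion_gammaFamily_le ha₀ hm⟩⟩

theorem mainTheorem4 :
    -- mean and variance of the three families
    (∀ lam : ℝ, 0 < lam →
      ∫ x, x ∂(ProbabilityTheory.expMeasure lam) = 1 / lam ∧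
      ProbabilityTheory.variance id (ProbabilityTheory.expMeasure lam) = 1 / lam ^ 2) ∧
    (∀ k : ℕ, 0 < k →
      ∫ x, x ∂(Voting.chiSquared k) = k ∧
      ProbabilityTheory.variance id (Voting.chiSquared k) = 2 * k) ∧
    (∀ (k : ℕ) (lam : ℝ), 0 < k → 0 < lam →
      ∫ x, x ∂(Voting.erlang k lam) = 1 / lam ∧
      ProbabilityTheory.variance id (Voting.erlang k lam) = 1 / (k * lam ^ 2)) ∧
    -- the bound on the average distortion, with one absolute constant
    ∃ C : ℝ, 0 < C ∧ ∀ m : ℕ, 2 ≤ m → ∃ T : MeasureTheory.Measure ℝ → Voting.Thresholds,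
      ∀ n : ℕ, 1 ≤ n → ∀ M : ℝ → Voting.Mechanism n m, Voting.IsMean M →
        Voting.avgDistortion (fun F => Voting.rtMean M (T F) F) Voting.exponentialFamily
          ≤ ENNReal.ofReal (C * Real.log m) ∧
        Voting.avgDistortion (fun F => Voting.rtMean M (T F) F) Voting.chiSquaredFamily
          ≤ ENNReal.ofReal (C * Real.log m) ∧
        Voting.avgDistortion (fun F => Voting.rtMean M (T F) F) Voting.erlangFamily
          ≤ ENNReal.ofReal (C * Real.log m) := by
  obtain ⟨hmoments, T, hT⟩ := mainTheorem4_general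
  obtain ⟨C, hC, hbound⟩ := hT (1 / 2) one_half_pos
  refine ⟨fun lam hlam => hmoments 1 lam one_pos hlam, fun k hk => ?_, fun k lam hk hlam => ?_,
    C, hC, fun m hm => ⟨T, fun n hn M hM => ?_⟩⟩
  · have hshape : (0 : ℝ) < k / 2 := half_pos (Nat.cast_pos.2 hk)
    obtain ⟨hmean, hvar⟩ := hmoments _ _ hshape one_half_pos
    exact ⟨hmean.trans (by ring), hvar.trans (by ring)⟩
  · have hshape : (0 : ℝ) < k := Nat.cast_pos.2 hk
    obtain ⟨hmean, hvar⟩ := hmoments _ _ hshape (mul_pos hshape hlam)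
    exact ⟨hmean.trans (by field_simp), hvar.trans (by field_simp)⟩
  · have hsubset := Voting.gammaFamily_antitone (one_half_lt_one (α := ℝ)).le
    have hmono := Voting.avgDistortion_mono fun F => Voting.rtMean M (T F) F
    have hgamma := hbound m hm n hn M hM
    exact ⟨(hmono (Voting.exponentialFamily_subset_gammaFamily.trans hsubset)).trans hgamma,
      (hmono Voting.chiSquaredFamily_subset_gammaFamily).trans hgamma,
      (hmono (Voting.erlangFamily_subset_gammaFamily.trans hsubset)).trans hgamma⟩
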